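/- Let $\mathcal H$ be a separable infinite-dimensional complex Hilbert space, let $B(\mathcal H)$ be the algebra of bounded operators on it, and let $B(\mathcal H)^d$ carry the topology given by the operator norm in each coordinate. Let $D\subseteq B(\mathcal H)^d$ be an open set containing $0$ and let $F:D\to B(\mathcal H)$. Suppose that 1. $F$ is *intertwining preserving*, that is: (i) whenever $x,y\in D$ and $T\in B(\mathcal H)$ satisfy $Tx^i=y^iT$ for $i=1,\dots,d$, then $TF(x)=F(y)T$; and (ii) whenever $(x_n)$ is a bounded (finite or infinite) sequence in $D$ and $s:\mathcal H\to\bigoplus_n\mathcal H$ is an invertible bounded linear operator such that the $d$-tuple $y=s^{-1}\,\mathrm{diag}(x_1,x_2,\dots)\,s$ lies in $D$, then $F(y)=s^{-1}\,\mathrm{diag}(F(x_1),F(x_2),\dots)\,s$; 2. $F$ is *sequentially strong operator continuous* (SSOC): whenever $x_n\in D$ ($n\in\mathbb N$) converge to $x\in D$ in the strong operator topology, coordinate by coordinate, then $F(x_n)\to F(x)$ in the strong operator topology. Then there are an open set $U\subseteq D$ containing $0$ and, for each $k\ge 1$, a free polynomial $P_k$ in $d$ noncommuting variables with complex coefficients,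 homogeneous of degree $k$ (i.e. a linear combination, possibly zero, of words of length $k$), such that $$F(x)=F(0)+\sum_{k=1}^\infty P_k(x)\qquad\text{for all }x\in U,$$ where the partial sums converge in operator norm, uniformly for $x\in U$. -/

import Mathlib

open Filter Topology

noncomputable section

/-- `B(H)`, the bounded linear operators on `H`. -/
abbrev BOp (H : Type*) [NormedAddCommGroup H] [InnerProductSpace ℂ H] := H →L[ℂ] H

/-- `B(H)^d`, with the topology (and boundedness) given by the operator norm in each coordinate. -/
abbrev OpTuple (H : Type*) [NormedAddCommGroup H] [InnerProductSpace ℂ H] (d : ℕ) :=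
  Fin d → BOp H

/-- The Hilbert space direct sum `⊕ H` of copies of `H` indexed by `ι`. -/
abbrev HilbertSum (ι : Type) (H : Type*) [NormedAddCommGroup H] [InnerProductSpace ℂ H] :=
  lp (fun _ : ι => H) 2

/-- The bounded operator `B` on `⊕ H` is the block diagonal operator `diag (A n)`. -/
def IsBlockDiag {ι : Type} {H : Type*} [NormedAddCommGroup H] [InnerProductSpace ℂ H]
    (A : ι → BOp H) (B : HilbertSum ι H →L[ℂ] HilbertSum ι H) : Prop :=
  ∀ (v : HilbertSum ι H) (n : ι), B v n = A n (v n)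

/-- `s T s⁻¹`, an operator on `⊕ H`, for an operator `T` on `H` and an invertible bounded
linear `s : H → ⊕ H`. -/
def conjBy {ι : Type} {H : Type*} [NormedAddCommGroup H] [InnerProductSpace ℂ H]
    (s : H ≃L[ℂ] HilbertSum ι H) (T : BOp H) : HilbertSum ι H →L[ℂ] HilbertSum ι H :=
  (s : H →L[ℂ] HilbertSum ι H) ∘L T ∘L (s.symm : HilbertSum ι H →L[ℂ] H)

/-- `F` is intertwining preserving on `D`. In the second clause a sequence may be finite or
infinite; `y = s⁻¹ diag (x n) s` is written as `s y s⁻¹ = diag (x n)`, coordinate by coordinate,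
and likewise the conclusion `F y = s⁻¹ diag (F (x n)) s` as `s (F y) s⁻¹ = diag (F (x n))`. -/
structure IntertwiningPreserving {H : Type*} [NormedAddCommGroup H] [InnerProductSpace ℂ H]
    {d : ℕ} (D : Set (OpTuple H d)) (F : OpTuple H d → BOp H) : Prop where
  intertwine : ∀ x ∈ D, ∀ y ∈ D, ∀ T : BOp H,
    (∀ i, T ∘L x i = y i ∘L T) → T ∘L F x = F y ∘L T
  directSum : ∀ (ι : Type) [Countable ι] (x : ι → OpTuple H d), (∀ n, x n ∈ D) →
    (∃ C : ℝ, ∀ n i, ‖x n i‖ ≤ C) →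
    ∀ (s : H ≃L[ℂ] HilbertSum ι H), ∀ y ∈ D,
      (∀ i, IsBlockDiag (fun n => x n i) (conjBy s (y i))) →
      IsBlockDiag (fun n => F (x n)) (conjBy s (F y))

/-- The sequence of operators `A n` converges to `B` in the strong operator topology. -/
def SOTTendsto {H : Type*} [NormedAddCommGroup H] [InnerProductSpace ℂ H]
    (A : ℕ → BOp H) (B : BOp H) : Prop :=
  ∀ v : H, Tendsto (fun n => A n v) atTop (𝓝 (B v))

/-- `F` is sequentially strong operator continuous on `D`. -/
def SSOC {H : Type*} [NormedAddCommGroup H] [InnerProductSpace ℂ H]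
    {d : ℕ} (D : Set (OpTuple H d)) (F : OpTuple H d → BOp H) : Prop :=
  ∀ (x : ℕ → OpTuple H d) (a : OpTuple H d), (∀ n, x n ∈ D) → a ∈ D →
    (∀ i, SOTTendsto (fun n => x n i) (a i)) → SOTTendsto (fun n => F (x n)) (F a)

/-- Free polynomials in `d` noncommuting variables with complex coefficients. -/
abbrev FreePoly (d : ℕ) := FreeAlgebra ℂ (Fin d)

/-- The value of a free polynomial at a `d`-tuple of operators. -/
def FreePoly.evalAt {H : Type*} [NormedAddCommGroup H] [InnerProductSpace ℂ H]
    {d : ℕ} (p : FreePoly d) (x : OpTuple H d) : BOp H :=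
  FreeAlgebra.lift ℂ x p

/-- `p` is homogeneous of degree `k`: a linear combination of words of length `k` (possibly `0`). -/
def FreePoly.IsHomogeneous {d : ℕ} (p : FreePoly d) (k : ℕ) : Prop :=
  p ∈ Submodule.span ℂ (Set.range fun w : Fin k → Fin d =>
    (List.ofFn fun j => FreeAlgebra.ι ℂ (w j)).prod)

end

open scoped InnerProductSpace

noncomputable section

/-! Creation operators `L i` on `⊕ H`, indexed by words, are universal for small tuples. If `‖z i‖ ≤
q` and `d * q < 1`, the bounded map `W = wordSum z`, sending `v` in summand `w` to `z^w v`,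
satisfies `W L i = z i W`. Embed `⊕ H` in `H` by an isometry `Φ` with adjoint `Ψ`, and let `y = r Φ
L Ψ`. Then `W Ψ` intertwines `y` with `r z`, so `F y` determines `F (r z)`: with `G = Ψ (F y) Φ`,
evaluation on the summand of the empty word gives `F (r z) = ∑ z^w C w`, where the `C w` are the
entries of the corresponding column of `G`.

The `C w` are scalars: ampliated isometries commute with `L`, hence with `G`, so each `C w` commutes
with every isometry. They are bounded by `‖F y‖`, so grouping words by length gives a series
dominated by a geometric one. The core is `exists_hasSum_wordProd`. -/

/-- The product of the entries of `x` along a word `w`. -/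
def wordProd {ι R : Type*} [Monoid R] (x : ι → R) (w : List ι) : R := (w.map x).prod

theorem norm_wordProd_le {ι R : Type*} [NormedRing R] [NormOneClass R] {x : ι → R} {q : ℝ}
    (hx : ∀ i, ‖x i‖ ≤ q) (w : List ι) : ‖wordProd x w‖ ≤ q ^ w.length := by
  induction w with
  | nil => simp [wordProd]
  | cons i w ih =>
    have h0 : 0 ≤ q := (norm_nonneg _).trans (hx i)
    calc ‖wordProd x (i :: w)‖ = ‖x i * wordProd x w‖ := by simp [wordProd]
      _ ≤ ‖x i‖ * ‖wordProd x w‖ := norm_mul_le _ _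
      _ ≤ q * q ^ w.length := by gcongr; exact hx i
      _ = q ^ (i :: w).length := by rw [List.length_cons, pow_succ']

/-- There are `d ^ n` words of length `n`, which leaves a geometric series of ratio `d * q`. -/
theorem summable_pow_length {d : ℕ} {q : ℝ} (hq : 0 ≤ q) (hdq : d * q < 1) :
    Summable fun w : List (Fin d) => q ^ w.length := by
  rw [← List.equivSigmaTuple.symm.summable_iff]
  refine (summable_sigma_of_nonneg fun _ => pow_nonneg hq _).2 ⟨fun n => Summable.of_finite, ?_⟩
  have : Summable fun n : ℕ => ((d : ℝ) * q) ^ n :=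
    summable_geometric_of_lt_one (by positivity) hdq
  refine this.congr fun n => ?_
  simp [List.equivSigmaTuple, tsum_fintype, mul_pow]

/-! ### Orthogonal copies of `H` inside `H`. -/

section Isometries

variable {H : Type*} [NormedAddCommGroup H] [InnerProductSpace ℂ H]

theorem inner_linearIsometry_eq_zero {ι E G : Type*} [DecidableEq ι] [NormedAddCommGroup E]
    [InnerProductSpace ℂ E]
    [NormedAddCommGroup G] [InnerProductSpace ℂ G] [CompleteSpace E]
    {V : ι → G →ₗᵢ[ℂ] E} (hV : OrthogonalFamily ℂ (fun _ => G) V) (z : E)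
    (h : ∀ i g, ⟪z, V i g⟫_ℂ = 0) (f : lp (fun _ : ι => G) 2) : ⟪z, hV.linearIsometry f⟫_ℂ = 0 := by
  have h1 := (hV.hasSum_linearIsometry f).mapL (innerSL ℂ z)
  simp only [innerSL_apply_apply, h] at h1
  exact h1.unique hasSum_zero

/-- An infinite-dimensional Hilbert space contains countably many mutually orthogonal isometric
copies of itself. -/
theorem exists_orthogonalFamily_self [CompleteSpace H] (hH : ¬ FiniteDimensional ℂ H)
    (ι : Type) [Countable ι] :
    ∃ V : ι → H →ₗᵢ[ℂ] H, OrthogonalFamily ℂ (fun _ => H) V := by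
  classical
  obtain ⟨J, b, -⟩ := exists_hilbertBasis ℂ H
  have hJ : Infinite J := by
    by_contra hfin
    have : Finite J := not_infinite_iff_finite.1 hfin
    have := Fintype.ofFinite J
    exact hH b.toOrthonormalBasis.toBasis.finiteDimensional_of_finite
  -- As `J` is infinite and `ι` countable, `ι × J` embeds in `J`; copy `w` is spanned by the basis
  -- vectors `b (e (w, j))`.
  obtain ⟨e⟩ : Nonempty (ι × J ↪ J) := by
    rw [← Cardinal.lift_mk_le']
    simp only [Cardinal.mk_prod, Cardinal.lift_id]
    refine (Cardinal.mul_le_max_of_aleph0_le_right (by simp)).trans (max_le ?_ (by simp))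
    exact (by simp : _ ≤ Cardinal.aleph0).trans (by simp)
  have ho (w : ι) : Orthonormal ℂ fun j => b (e (w, j)) :=
    b.orthonormal.comp _ fun j k h => (Prod.mk.inj (e.injective h)).2
  refine ⟨fun w => (ho w).orthogonalFamily.linearIsometry.comp b.repr.toLinearIsometry, ?_⟩
  intro w u hwu x y
  refine inner_linearIsometry_eq_zero (ho u).orthogonalFamily _ (fun j c => ?_) _
  rw [← inner_conj_symm, map_eq_zero]
  refine inner_linearIsometry_eq_zero (ho w).orthogonalFamily _ (fun k a => ?_) _
  simp only [LinearIsometry.toSpanSingleton_apply, inner_smul_left, inner_smul_right]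
  rw [b.orthonormal.2, mul_zero, mul_zero]
  intro h
  exact hwu (Prod.mk.inj (e.injective h)).1.symm

end Isometries

/-! ### Scalar operators and shifts on `⊕ H`. -/

section BlockOperators

variable {ι H : Type*} [NormedAddCommGroup H] [InnerProductSpace ℂ H]

theorem lp_hom_ext [DecidableEq ι] {F : Type*} [NormedAddCommGroup F] [NormedSpace ℂ F]
    {A B : lp (fun _ : ι => H) 2 →L[ℂ] F}
    (h : ∀ w v, A (lp.single 2 w v) = B (lp.single 2 w v)) : A = B :=
  lp.ext_continuousLinearMap (by norm_num) fun w => ContinuousLinearMap.ext fun v => h w v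

/-- An operator that commutes with all isometries is a scalar. -/
theorem exists_eq_smul_one_of_commute_isometry (C : BOp H)
    (hC : ∀ B : H →ₗᵢ[ℂ] H, ∀ v, C (B v) = B (C v)) : ∃ c : ℂ, C = c • (1 : BOp H) := by
  -- The fixed vectors of the reflection in the line of `v` are exactly that line, and `C v` is
  -- fixed because `v` is. So every vector is an eigenvector.
  have key (v : H) : ∃ c : ℂ, C v = c • v := by
    have h := hC (ℂ ∙ v).reflection.toLinearIsometry v
    have hv : (ℂ ∙ v).reflection v = v :=
      Submodule.reflection_mem_subspace_eq_self (Submodule.mem_span_singleton_self v)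
    simp only [LinearIsometryEquiv.coe_toLinearIsometry, hv] at h
    obtain ⟨c, hc⟩ := Submodule.mem_span_singleton.1
      ((Submodule.reflection_eq_self_iff (C v)).1 h.symm)
    exact ⟨c, hc.symm⟩
  obtain ⟨c, hc⟩ := (C : H →ₗ[ℂ] H).exists_eq_smul_id_of_forall_notLinearIndependent fun v => by
    obtain ⟨c, hc⟩ := key v
    rw [LinearIndependent.pair_iff]
    intro h
    have := h c (-1) (by simp [hc])
    simp at this
  exact ⟨c, ContinuousLinearMap.ext fun v => by simpa using LinearMap.congr_fun hc v⟩

/-- The inclusion of `H` as the summand of `⊕ H` with index `w`. -/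
def singleIsometry [DecidableEq ι] (w : ι) : H →ₗᵢ[ℂ] lp (fun _ : ι => H) 2 :=
  { lp.singleContinuousLinearMap ℂ (fun _ : ι => H) 2 w with
    norm_map' := fun h => lp.norm_single (p := 2) (E := fun _ : ι => H) (by norm_num) w h }

theorem singleIsometry_apply [DecidableEq ι] (w : ι) (h : H) :
    singleIsometry w h = lp.single (E := fun _ : ι => H) 2 w h := rfl

theorem orthogonalFamily_single_comp [DecidableEq ι] (f : ι → ι) (hf : f.Injective)
    (B : H →ₗᵢ[ℂ] H) :
    OrthogonalFamily ℂ (fun _ : ι => H) fun w => (singleIsometry (f w)).comp B := by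
  intro w u hwu x y
  change ⟪singleIsometry (f w) (B x), singleIsometry (f u) (B y)⟫_ℂ = 0
  rw [singleIsometry_apply, singleIsometry_apply, lp.inner_single_left, lp.single_apply_ne _ _ _ (hf.ne hwu),
    inner_zero_right]

/-- The operator on `⊕ H` that applies `B` to each summand and moves the summand with index `w`
to the summand with index `f w`. -/
def blockShift [CompleteSpace H] [DecidableEq ι] (f : ι → ι) (hf : f.Injective) (B : H →ₗᵢ[ℂ] H) :
    lp (fun _ : ι => H) 2 →L[ℂ] lp (fun _ : ι => H) 2 :=
  (orthogonalFamily_single_comp f hf B).linearIsometry.toContinuousLinearMap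

variable [CompleteSpace H] [DecidableEq ι]

theorem blockShift_single {f : ι → ι} (hf : f.Injective) (B : H →ₗᵢ[ℂ] H) (w : ι) (h : H) :
    blockShift f hf B (lp.single 2 w h) = lp.single 2 (f w) (B h) :=
  (orthogonalFamily_single_comp f hf B).linearIsometry_apply_single h

theorem norm_blockShift_le {f : ι → ι} (hf : f.Injective) (B : H →ₗᵢ[ℂ] H) :
    ‖blockShift f hf B‖ ≤ 1 :=
  LinearIsometry.norm_toContinuousLinearMap_le _

end BlockOperators

/-! ### Power series expansion from the creation operators. -/

section WordSeries

variable {H : Type*} [NormedAddCommGroup H] [InnerProductSpace ℂ H] [CompleteSpace H] {d : ℕ}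

theorem summable_of_opNorm_bounded {ι E F : Type*} [NormedAddCommGroup E] [NormedSpace ℂ E]
    [NormedAddCommGroup F] [NormedSpace ℂ F] [CompleteSpace F] {f : ι → E →L[ℂ] F} {u : ι → ℝ}
    (hu : Summable u) (h : ∀ w, ‖f w‖ ≤ u w) : Summable f :=
  .of_norm_bounded hu h

theorem summable_wordProd_comp_eval {x : OpTuple H d} {q : ℝ} (hq : 0 ≤ q) (hdq : d * q < 1)
    (hx : ∀ i, ‖x i‖ ≤ q) (hH : Nontrivial H) :
    Summable fun w : List (Fin d) =>
      (wordProd x w).comp (lp.evalCLM ℂ (fun _ : List (Fin d) => H) 2 w) := by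
  refine summable_of_opNorm_bounded (E := lp (fun _ : List (Fin d) => H) 2)
    (summable_pow_length hq hdq) fun w => (ContinuousLinearMap.opNorm_comp_le _ _).trans ?_
  have h1 : ‖lp.evalCLM ℂ (fun _ : List (Fin d) => H) 2 w‖ ≤ 1 :=
    LinearMap.mkContinuous_norm_le _ zero_le_one _
  exact (mul_le_of_le_one_right (norm_nonneg _) h1).trans (norm_wordProd_le hx w)

/-- The operator `⊕ H → H` that sends the vector `v` in the summand of the word `w` to
`x^w v`. -/
def wordSum (x : OpTuple H d) : lp (fun _ : List (Fin d) => H) 2 →L[ℂ] H :=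
  ∑' w : List (Fin d), (wordProd x w).comp (lp.evalCLM ℂ (fun _ : List (Fin d) => H) 2 w)

theorem hasSum_wordSum {x : OpTuple H d} {q : ℝ} (hq : 0 ≤ q) (hdq : d * q < 1)
    (hx : ∀ i, ‖x i‖ ≤ q) (hH : Nontrivial H) :
    HasSum (fun w : List (Fin d) =>
      (wordProd x w).comp (lp.evalCLM ℂ (fun _ : List (Fin d) => H) 2 w)) (wordSum x) :=
  (summable_wordProd_comp_eval hq hdq hx hH).hasSum

theorem wordSum_single {x : OpTuple H d} {q : ℝ} (hq : 0 ≤ q) (hdq : d * q < 1)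
    (hx : ∀ i, ‖x i‖ ≤ q) (hH : Nontrivial H) (w : List (Fin d)) (v : H) :
    wordSum x (lp.single 2 w v) = wordProd x w v := by
  have h1 := (hasSum_wordSum hq hdq hx hH).mapL (ContinuousLinearMap.apply ℂ H (lp.single 2 w v))
  refine h1.unique ?_
  have h2 := hasSum_single (f := fun u : List (Fin d) => wordProd x u
    ((lp.single (E := fun _ : List (Fin d) => H) 2 w v) u)) w fun u hu => by
      rw [lp.single_apply_ne _ _ _ hu, map_zero]
  rw [lp.single_apply_self] at h2
  exact h2

theorem wordSum_comp_creation {x : OpTuple H d} {q : ℝ} (hq : 0 ≤ q) (hdq : d * q < 1)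
    (hx : ∀ i, ‖x i‖ ≤ q) (hH : Nontrivial H) (i : Fin d) :
    (wordSum x).comp (blockShift (List.cons i) List.cons_injective .id) = (x i).comp (wordSum x) :=
  lp_hom_ext fun w v => by
    rw [ContinuousLinearMap.comp_apply, ContinuousLinearMap.comp_apply, blockShift_single,
      wordSum_single hq hdq hx hH, wordSum_single hq hdq hx hH]
    simp [wordProd]

/-- Only intertwinings of `y` with itself and with `r z` are used: the former make the coefficients
scalar, the latter give the expansion. -/
theorem exists_hasSum_wordProd (hH : ¬ FiniteDimensional ℂ H) {D : Set (OpTuple H d)}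
    {F : OpTuple H d → BOp H}
    (hF : ∀ x ∈ D, ∀ y ∈ D, ∀ T : BOp H, (∀ i, T ∘L x i = y i ∘L T) → T ∘L F x = F y ∘L T)
    {r : ℝ} (hr : 0 ≤ r) (hD : ∀ x : OpTuple H d, (∀ i, ‖x i‖ ≤ r) → x ∈ D)
    {q : ℝ} (hq : 0 ≤ q) (hq1 : q ≤ 1) (hdq : d * q < 1) :
    ∃ (c : List (Fin d) → ℂ) (M : ℝ), (∀ w, ‖c w‖ ≤ M) ∧
      ∀ z : OpTuple H d, (∀ i, ‖z i‖ ≤ q) →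
        HasSum (fun w => c w • wordProd z w) (F ((r : ℂ) • z)) := by
  have hnt : Nontrivial H := by
    by_contra h
    rw [not_nontrivial_iff_subsingleton] at h
    exact hH inferInstance
  obtain ⟨V, hV⟩ := exists_orthogonalFamily_self hH (List (Fin d))
  let Φ : lp (fun _ : List (Fin d) => H) 2 →L[ℂ] H := hV.linearIsometry.toContinuousLinearMap
  let Ψ : H →L[ℂ] lp (fun _ : List (Fin d) => H) 2 := Φ.adjoint
  have hΨΦ : Ψ ∘L Φ = .id ℂ _ :=
    (ContinuousLinearMap.norm_map_iff_adjoint_comp_self Φ).1 hV.linearIsometry.norm_map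
  have hΦ1 : ‖Φ‖ ≤ 1 := LinearIsometry.norm_toContinuousLinearMap_le _
  have hΨ1 : ‖Ψ‖ ≤ 1 := by rwa [LinearIsometryEquiv.norm_map]
  have hΨΦa (v) : Ψ (Φ v) = v := congr($hΨΦ v)
  let L (i : Fin d) : lp (fun _ : List (Fin d) => H) 2 →L[ℂ] lp (fun _ : List (Fin d) => H) 2 :=
    blockShift (List.cons i) List.cons_injective .id
  let y : OpTuple H d := fun i => (r : ℂ) • (Φ ∘L L i ∘L Ψ)
  have hy : y ∈ D := hD _ fun i => by
    have h1 : ‖Φ ∘L L i ∘L Ψ‖ ≤ 1 * (1 * 1) :=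
      (ContinuousLinearMap.opNorm_comp_le _ _).trans <| mul_le_mul hΦ1
        ((ContinuousLinearMap.opNorm_comp_le _ _).trans <|
          mul_le_mul (norm_blockShift_le _ _) hΨ1 (norm_nonneg _) zero_le_one)
        (norm_nonneg _) zero_le_one
    rw [norm_smul, Complex.norm_of_nonneg hr]
    exact mul_le_of_le_one_right hr (by simpa using h1)
  let G : lp (fun _ : List (Fin d) => H) 2 →L[ℂ] lp (fun _ : List (Fin d) => H) 2 :=
    Ψ ∘L F y ∘L Φ
  let C (w : List (Fin d)) : BOp H := lp.evalCLM ℂ (fun _ : List (Fin d) => H) 2 w ∘L G ∘L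
    lp.singleContinuousLinearMap ℂ (fun _ : List (Fin d) => H) 2 []
  -- `G` commutes with the ampliations of isometries, since these commute with `L`
  have hGB (B : H →ₗᵢ[ℂ] H) (v) :
      G (blockShift id Function.injective_id B v) = blockShift id Function.injective_id B (G v) := by
    have hLB (i : Fin d) : blockShift id Function.injective_id B ∘L L i =
        L i ∘L blockShift id Function.injective_id B :=
      lp_hom_ext fun w v => by
        simp only [L, ContinuousLinearMap.comp_apply, blockShift_single]
        rfl
    have h := hF y hy y hy (Φ ∘L blockShift id Function.injective_id B ∘L Ψ) fun i => by
      ext v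
      have := congr($(hLB i) (Ψ v))
      simp only [ContinuousLinearMap.comp_apply] at this
      simp [y, hΨΦa, this]
    have h2 := congr(Ψ ($h (Φ v)))
    simp only [ContinuousLinearMap.comp_apply, hΨΦa] at h2
    exact h2.symm
  have hC (w : List (Fin d)) : ∃ c : ℂ, C w = c • (1 : BOp H) := by
    refine exists_eq_smul_one_of_commute_isometry _ fun B v => ?_
    have hev : lp.evalCLM ℂ (fun _ : List (Fin d) => H) 2 w ∘L
        blockShift id Function.injective_id B =
        B.toContinuousLinearMap ∘L lp.evalCLM ℂ (fun _ : List (Fin d) => H) 2 w :=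
      lp_hom_ext fun u v => by
        rw [ContinuousLinearMap.comp_apply, ContinuousLinearMap.comp_apply, blockShift_single]
        change lp.single (E := fun _ : List (Fin d) => H) 2 u (B v) w =
          B (lp.single (E := fun _ : List (Fin d) => H) 2 u v w)
        by_cases h : w = u
        · subst h
          rw [lp.single_apply_self, lp.single_apply_self]
        · rw [lp.single_apply_ne _ _ _ h, lp.single_apply_ne _ _ _ h, map_zero]
    have h1 := hGB B (lp.single 2 [] v)
    rw [blockShift_single] at h1
    have h2 := congr($hev (G (lp.single 2 [] v)))
    rw [ContinuousLinearMap.comp_apply, ← h1] at h2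
    exact h2
  choose c hc using hC
  -- Each `C w` is a block of `F y` compressed by contractions, hence the bound.
  refine ⟨c, ‖F y‖, fun w => ?_, fun z hz => ?_⟩
  · obtain ⟨v, hv⟩ := exists_ne (0 : H)
    have h1 : ‖C w v‖ ≤ ‖F y‖ * ‖v‖ := by
      calc ‖C w v‖ ≤ ‖G (lp.single 2 [] v)‖ := lp.norm_apply_le_norm (by norm_num) _ w
        _ ≤ ‖F y (Φ (lp.single 2 [] v))‖ :=
          (Ψ.le_of_opNorm_le hΨ1 _).trans_eq (one_mul _)
        _ ≤ ‖F y‖ * ‖Φ (lp.single 2 [] v)‖ := (F y).le_opNorm _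
        _ = ‖F y‖ * ‖v‖ := by
          rw [show ‖Φ (lp.single 2 [] v)‖ = ‖lp.single (E := fun _ : List (Fin d) => H) 2 [] v‖ from
            hV.linearIsometry.norm_map _, lp.norm_single (by norm_num)]
    rw [hc, smul_apply, one_apply_eq_self, norm_smul] at h1
    exact le_of_mul_le_mul_right h1 (norm_pos_iff.2 hv)
  · have hzD : (r : ℂ) • z ∈ D := hD _ fun i => by
      rw [Pi.smul_apply, norm_smul, Complex.norm_of_nonneg hr]
      exact mul_le_of_le_one_right hr ((hz i).trans hq1)
    have h := hF y hy _ hzD (wordSum z ∘L Ψ) fun i => by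
      ext v
      have := congr($(wordSum_comp_creation hq hdq hz hnt i) (Ψ v))
      simp only [ContinuousLinearMap.comp_apply] at this
      simp [y, hΨΦa, L, this]
    have hFz : F ((r : ℂ) • z) = wordSum z ∘L
        (G ∘L lp.singleContinuousLinearMap ℂ (fun _ : List (Fin d) => H) 2 []) := by
      ext v
      -- On the summand of the empty word, `W` acts as the identity.
      have h2 := congr($h (Φ (lp.single 2 [] v)))
      simp only [ContinuousLinearMap.comp_apply, hΨΦa, wordSum_single hq hdq hz hnt] at h2
      exact h2.symm
    rw [hFz]
    have h3 := (hasSum_wordSum hq hdq hz hnt).mapL ((ContinuousLinearMap.compL ℂ H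
      (lp (fun _ : List (Fin d) => H) 2) H).flip
      (G ∘L lp.singleContinuousLinearMap ℂ (fun _ : List (Fin d) => H) 2 []))
    have hterm : (fun w => c w • wordProd z w) = fun w => wordProd z w ∘L C w := by
      ext w v
      simp [hc]
    rw [hterm]
    exact h3

end WordSeries

/-! ### Grouping words by length. -/

section Grading

variable {H : Type*} [NormedAddCommGroup H] [InnerProductSpace ℂ H] {d : ℕ}

theorem wordProd_smul (a : ℂ) (x : OpTuple H d) (w : List (Fin d)) :
    wordProd (a • x) w = a ^ w.length • wordProd x w := by
  induction w with
  | nil => simp [wordProd]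
  | cons i w ih =>
    have h (y : OpTuple H d) : wordProd y (i :: w) = y i * wordProd y w := by simp [wordProd]
    rw [h, h, ih, Pi.smul_apply, smul_mul_smul_comm, List.length_cons, pow_succ']

/-- The free polynomial of degree `k` with coefficient `c w * a ^ k` at each word `w` of
length `k`. -/
def homogeneousPart (c : List (Fin d) → ℂ) (a : ℂ) (k : ℕ) : FreePoly d :=
  ∑ w : Fin k → Fin d, (c (List.ofFn w) * a ^ k) •
    (List.ofFn fun j => FreeAlgebra.ι ℂ (w j)).prod

theorem isHomogeneous_homogeneousPart (c : List (Fin d) → ℂ) (a : ℂ) (k : ℕ) :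
    (homogeneousPart c a k).IsHomogeneous k :=
  Submodule.sum_mem _ fun w _ => Submodule.smul_mem _ _ (Submodule.subset_span ⟨w, rfl⟩)

theorem evalAt_homogeneousPart (c : List (Fin d) → ℂ) (a : ℂ) (k : ℕ) (x : OpTuple H d) :
    (homogeneousPart c a k).evalAt x =
      ∑ w : Fin k → Fin d, c (List.ofFn w) • wordProd (a • x) (List.ofFn w) := by
  simp only [FreePoly.evalAt, homogeneousPart, map_sum, map_smul, map_list_prod, List.map_ofFn,
    wordProd_smul, List.length_ofFn, smul_smul]
  refine Finset.sum_congr rfl fun w _ => ?_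
  rw [wordProd, List.map_ofFn]
  congr 3
  ext j
  simp

end Grading

end

/-- Near `0`, a function `F` that respects intertwinings is a norm-convergent free power series.
The coefficients are read off from the value of `F` at a multiple of the creation operators on the
full Fock space with coefficients in `H`, embedded isometrically in `H`; every small tuple `x` is
intertwined with that one. Neither the direct sums nor the SOT continuity are needed. -/
theorem mainTheorem4 {H : Type*} [NormedAddCommGroup H] [InnerProductSpace ℂ H]
    [CompleteSpace H] [TopologicalSpace.SeparableSpace H] (hH : ¬ FiniteDimensional ℂ H)
    (d : ℕ) (D : Set (OpTuple H d)) (hD : IsOpen D) (h0 : (0 : OpTuple H d) ∈ D)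
    (F : OpTuple H d → BOp H) (hIP : IntertwiningPreserving D F) (hF : SSOC D F) :
    ∃ (U : Set (OpTuple H d)) (P : ℕ → FreePoly d),
      IsOpen U ∧ U ⊆ D ∧ (0 : OpTuple H d) ∈ U ∧
      (∀ k, 1 ≤ k → FreePoly.IsHomogeneous (P k) k) ∧
      TendstoUniformlyOn
        (fun (N : ℕ) (x : OpTuple H d) =>
          F 0 + ∑ k ∈ Finset.Icc 1 N, FreePoly.evalAt (P k) x)
        F atTop U := by
  have hnt : Nontrivial H := by
    by_contra h
    rw [not_nontrivial_iff_subsingleton] at h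
    exact hH inferInstance
  obtain ⟨r, hr, hrD⟩ := Metric.nhds_basis_closedBall.mem_iff.1 (hD.mem_nhds h0)
  have hrD' (x : OpTuple H d) (hx : ∀ i, ‖x i‖ ≤ r) : x ∈ D :=
    hrD (mem_closedBall_zero_iff.2 ((pi_norm_le_iff_of_nonneg hr.le).2 hx))
  -- This choice gives `d * q < 1` and `q ≤ 1` for every `d`, including `d = 0`.
  let q : ℝ := 1 / (d + 1)
  have hq : 0 < q := by positivity
  have hq1 : q ≤ 1 := by
    rw [div_le_one (by positivity)]
    linarith [(Nat.cast_nonneg d : (0 : ℝ) ≤ d)]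
  have hdq : d * q < 1 := by
    rw [mul_one_div, div_lt_one (by positivity)]
    linarith
  obtain ⟨c, M, hcM, hc⟩ := exists_hasSum_wordProd hH hIP.intertwine hr.le hrD' hq.le hq1 hdq
  have hrc : (r : ℂ) ≠ 0 := by exact_mod_cast hr.ne'
  -- The factor `r⁻¹` undoes the rescaling `z = r⁻¹ x`.
  let P : ℕ → FreePoly d := homogeneousPart c (r : ℂ)⁻¹
  let U : Set (OpTuple H d) := Metric.ball 0 (r * q)
  have hU {x : OpTuple H d} (hx : x ∈ U) (i : Fin d) : ‖((r : ℂ)⁻¹ • x) i‖ ≤ q := by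
    have h1 := (norm_le_pi_norm x i).trans (mem_ball_zero_iff.1 hx).le
    rw [Pi.smul_apply, norm_smul, norm_inv, Complex.norm_of_nonneg hr.le, inv_mul_le_iff₀ hr]
    exact h1
  have h0U : (0 : OpTuple H d) ∈ U := Metric.mem_ball_self (by positivity)
  have hsum {x : OpTuple H d} (hx : x ∈ U) : HasSum (fun k => (P k).evalAt x) (F x) := by
    have h1 := hc _ (hU hx)
    rw [smul_inv_smul₀ hrc, ← List.equivSigmaTuple.symm.hasSum_iff] at h1
    refine h1.sigma fun k => ?_
    rw [evalAt_homogeneousPart]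
    exact hasSum_fintype _
  have hbound (k : ℕ) (x : OpTuple H d) (hx : x ∈ U) :
      ‖(P k).evalAt x‖ ≤ M * (d * q) ^ k := by
    rw [evalAt_homogeneousPart]
    refine (norm_sum_le_of_le _ fun w _ => ?_).trans_eq
      (b := ∑ _w : Fin k → Fin d, M * q ^ k) ?_
    · rw [norm_smul]
      refine mul_le_mul (hcM _) ?_ (norm_nonneg _) ((norm_nonneg _).trans (hcM []))
      simpa using norm_wordProd_le (hU hx) (List.ofFn w)
    · simp [mul_pow]
      ring
  have hP0 (x : OpTuple H d) : (P 0).evalAt x = c [] • (1 : BOp H) := by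
    simp [P, evalAt_homogeneousPart, wordProd]
  have hF0 : F 0 = c [] • (1 : BOp H) := by
    refine (hsum h0U).unique ?_
    rw [← hP0 0]
    refine hasSum_single 0 fun k hk => ?_
    rw [evalAt_homogeneousPart]
    refine Finset.sum_eq_zero fun w _ => ?_
    rw [smul_zero, ← zero_smul ℂ (0 : OpTuple H d), wordProd_smul, List.length_ofFn,
      zero_pow hk, zero_smul, smul_zero]
  refine ⟨U, P, Metric.isOpen_ball, fun x hx => hrD ?_, h0U,
    fun k _ => isHomogeneous_homogeneousPart c _ k, ?_⟩
  · exact Metric.ball_subset_closedBall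
      (Metric.ball_subset_ball (mul_le_of_le_one_right hr.le hq1) hx)
  have hu : Summable fun k : ℕ => M * (d * q) ^ k :=
    (summable_geometric_of_lt_one (by positivity) hdq).mul_left M
  -- Weierstrass M-test. The range `N + 1` includes degree `0`, whose term is `F 0`, so degrees `1`
  -- to `N` remain.
  have h1 : TendstoUniformlyOn (fun (N : ℕ) (x : OpTuple H d) =>
      ∑ k ∈ Finset.range (N + 1), (P k).evalAt x) F atTop U := by
    have h2 := (tendstoUniformlyOn_tsum_nat hu hbound).congr_right
      fun x hx => (hsum hx).tsum_eq
    exact fun v hv => (tendsto_add_atTop_nat 1).eventually (h2 v hv)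
  refine h1.congr (Eventually.of_forall fun N x _ => ?_)
  change ∑ k ∈ Finset.range (N + 1), (P k).evalAt x = _
  rw [Finset.sum_range_succ', hP0, ← hF0, add_comm, Finset.range_eq_Ico,
    Finset.sum_Ico_add' (fun k => (P k).evalAt x) 0 N 1]
  rfl
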